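/- Let $X$ be a real Banach space. For sequences $(z_n)_{n\in\mathbb N}$ in $X$, convergence of $\sum_n z_n$ means norm convergence of the partial sums $\sum_{i\le n}z_i$. If $E,F$ are equivalence relations on topological spaces $A,B$, then $E\le_B F$ means that there is a Borel map $\theta:A\to B$ with $x\mathrel E y\iff\theta(x)\mathrel F\theta(y)$ for all $x,y\in A$. For a linear subspace $L\subseteq\mathbb R^{\mathbb N}$, $\mathbb R^{\mathbb N}/L$ denotes the equivalence relation $a-b\in L$ on $\mathbb R^{\mathbb N}$; $\ell_\infty$ is the space of bounded real sequences. Products carry the product topology, and a set is $F_\sigma$ if it is a countable union of closed sets. (a) Suppose $X$ is separable and $(X_n)_{n\in\mathbb N}$ is a Schauder decomposition of $X$, i.e. a sequence of closed linear subspaces such that every $x\in X$ has a unique representation $x=\sum_n x_n$ with $x_n\in X_n$ for each $n$. Then the following are equivalent: 1. $(X_n)$ is boundedly complete: for every $\alpha\in\prod_nX_n$ with $\sup_n\|\sum_{i\le n}\alpha(i)\|<\infty$, the series $\sum_n\alpha(n)$ converges; 2. $\mathrm{cs}(X,(X_n))=\{\alpha\in\prod_nX_n:\sum_n\alpha(n)\text{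 converges}\}$ is $F_\sigma$ in $\prod_nX_n$; 3. $E(X,(X_n))\le_B\mathbb R^{\mathbb N}/\ell_\infty$, where $E(X,(X_n))$ is the equivalence relation on $\prod_nX_n$ given by $(\alpha,\beta)\in E(X,(X_n))\iff\sum_n(\alpha(n)-\beta(n))$ converges. (b) Suppose $(x_n)_{n\in\mathbb N}$ is a Schauder basis of $X$, i.e. for every $y\in X$ there is a unique $a\in\mathbb R^{\mathbb N}$ with $y=\sum_na(n)x_n$. Then the following are equivalent: 1. $(x_n)$ is boundedly complete: for every $a\in\mathbb R^{\mathbb N}$ with $\sup_n\|\sum_{i\le n}a(i)x_i\|<\infty$, the series $\sum_na(n)x_n$ converges; 2. $\mathrm{coef}(X,(x_n))=\{a\in\mathbb R^{\mathbb N}:\sum_na(n)x_n\text{ converges}\}$ is $F_\sigma$ in $\mathbb R^{\mathbb N}$; 3. $E(X,(x_n))=\mathbb R^{\mathbb N}/\mathrm{coef}(X,(x_n))\le_B\mathbb R^{\mathbb N}/\ell_\infty$. -/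

import Mathlib

open Filter Topology

/-- The series `∑ xₙ` (with terms taken in their natural order) converges in norm to `s`. -/
def SeriesHasSum {X : Type*} [NormedAddCommGroup X] (x : ℕ → X) (s : X) : Prop :=
  Tendsto (fun n => ∑ i ∈ Finset.range n, x i) atTop (𝓝 s)

/-- The series `∑ xₙ` (with terms taken in their natural order) converges in norm. -/
def SeriesConverges {X : Type*} [NormedAddCommGroup X] (x : ℕ → X) : Prop :=
  ∃ s : X, SeriesHasSum x s

/-- The partial sums of the series `∑ xₙ` are bounded in norm. -/
def PartialSumsBounded {X : Type*} [NormedAddCommGroup X] (x : ℕ → X) : Prop :=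
  ∃ C : ℝ, ∀ n : ℕ, ‖∑ i ∈ Finset.range (n + 1), x i‖ ≤ C

section Series

variable {X : Type*} [NormedAddCommGroup X]

theorem SeriesConverges.zero : SeriesConverges (fun _ : ℕ => (0 : X)) :=
  ⟨0, by simp [SeriesHasSum]⟩

theorem SeriesConverges.add {x y : ℕ → X} (hx : SeriesConverges x) (hy : SeriesConverges y) :
    SeriesConverges (fun n => x n + y n) := by
  obtain ⟨s, hs⟩ := hx
  obtain ⟨t, ht⟩ := hy
  exact ⟨s + t, by simpa [SeriesHasSum, Finset.sum_add_distrib] using Tendsto.add hs ht⟩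

theorem SeriesConverges.smul [NormedSpace ℝ X] {x : ℕ → X} (c : ℝ) (hx : SeriesConverges x) :
    SeriesConverges (fun n => c • x n) := by
  obtain ⟨s, hs⟩ := hx
  exact ⟨c • s, by simpa [SeriesHasSum, Finset.smul_sum] using Tendsto.const_smul hs c⟩

end Series

/-- `s` is an `F_σ` set: a countable union of closed sets. -/
def IsFsigma {Y : Type*} [TopologicalSpace Y] (s : Set Y) : Prop :=
  ∃ F : ℕ → Set Y, (∀ n, IsClosed (F n)) ∧ s = ⋃ n, F n

/-- Borel reducibility `E ≤_B F`: there is a Borel map `θ` with `x E y ↔ θ x F θ y`. -/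
def BorelReducible {A B : Type*} [TopologicalSpace A] [TopologicalSpace B]
    (E : Setoid A) (F : Setoid B) : Prop :=
  ∃ θ : A → B, @Measurable A B (borel A) (borel B) θ ∧ ∀ x y : A, E x y ↔ F (θ x) (θ y)

/-- The equivalence relation `ℝ^ℕ / L`: `a` and `b` are equivalent iff `a - b ∈ L`. -/
def modRel (L : Submodule ℝ (ℕ → ℝ)) : Setoid (ℕ → ℝ) where
  r a b := a - b ∈ L
  iseqv :=
    { refl := fun a => by simp
      symm := fun {a b} h => by simpa using L.neg_mem h
      trans := fun {a b c} h k => by simpa using L.add_mem h k }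

/-- The space `ℓ_∞` of bounded real sequences, as a subspace of `ℝ^ℕ`. -/
def ellInfty : Submodule ℝ (ℕ → ℝ) where
  carrier := {a | ∃ C : ℝ, ∀ n, |a n| ≤ C}
  zero_mem' := ⟨0, fun n => by simp⟩
  add_mem' := by
    rintro a b ⟨C, hC⟩ ⟨D, hD⟩
    exact ⟨C + D, fun n => (abs_add_le _ _).trans (add_le_add (hC n) (hD n))⟩
  smul_mem' := by
    rintro c a ⟨C, hC⟩
    refine ⟨|c| * C, fun n => ?_⟩
    rw [Pi.smul_apply, smul_eq_mul, abs_mul]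
    exact mul_le_mul_of_nonneg_left (hC n) (abs_nonneg c)

section Decomposition

variable {X : Type*} [NormedAddCommGroup X] [NormedSpace ℝ X]

/-- A sequence `(Vₙ)` of closed subspaces of `X` is a Schauder decomposition of `X` if every
`x : X` is the sum of exactly one series `∑ αₙ` with `αₙ ∈ Vₙ` for all `n`. -/
def IsSchauderDecomposition (V : ℕ → Submodule ℝ X) : Prop :=
  (∀ n, IsClosed (V n : Set X)) ∧
    ∀ x : X, ∃! α : (n : ℕ) → V n, SeriesHasSum (fun n => (α n : X)) x

/-- Every series `∑ αₙ` with `αₙ ∈ Vₙ` and bounded partial sums converges. -/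
def IsBoundedlyCompleteDecomposition (V : ℕ → Submodule ℝ X) : Prop :=
  ∀ α : (n : ℕ) → V n,
    PartialSumsBounded (fun n => (α n : X)) → SeriesConverges (fun n => (α n : X))

/-- `cs(X,(Vₙ))`: the set of `α ∈ ∏ Vₙ` for which `∑ αₙ` converges in `X`. -/
def csSet (V : ℕ → Submodule ℝ X) : Set ((n : ℕ) → V n) :=
  {α | SeriesConverges (fun n => (α n : X))}

/-- `E(X,(Vₙ))`: the equivalence relation on `∏ Vₙ` relating `α` and `β` iff `∑ (αₙ - βₙ)`
converges in `X`. -/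
def decompositionRel (V : ℕ → Submodule ℝ X) : Setoid ((n : ℕ) → V n) where
  r α β := SeriesConverges (fun n => (α n : X) - (β n : X))
  iseqv :=
    { refl := fun α => by simpa using SeriesConverges.zero (X := X)
      symm := fun {α β} h => by simpa using h.smul (-1)
      trans := fun {α β γ} h k => by simpa using h.add k }

/-- A sequence `(xₙ)` in `X` is a Schauder basis of `X` if for every `y : X` there is exactly one
real sequence `a` with `y = ∑ aₙ xₙ`. -/
def IsSchauderBasis (x : ℕ → X) : Prop :=
  ∀ y : X, ∃! a : ℕ → ℝ, SeriesHasSum (fun n => a n • x n) y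

/-- Every series `∑ aₙ xₙ` with bounded partial sums converges. -/
def IsBoundedlyCompleteBasis (x : ℕ → X) : Prop :=
  ∀ a : ℕ → ℝ, PartialSumsBounded (fun n => a n • x n) → SeriesConverges (fun n => a n • x n)

/-- `coef(X,(xₙ))`: the subspace of all `a ∈ ℝ^ℕ` for which `∑ aₙ xₙ` converges in `X`. -/
def coef (x : ℕ → X) : Submodule ℝ (ℕ → ℝ) where
  carrier := {a | SeriesConverges (fun n => a n • x n)}
  zero_mem' := by simpa using SeriesConverges.zero (X := X)
  add_mem' := fun {a b} ha hb => by simpa [add_smul] using SeriesConverges.add ha hb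
  smul_mem' := fun c a ha => by simpa [mul_smul] using SeriesConverges.smul c ha

/-- The Schauder equivalence relation `E(X,(xₙ)) = ℝ^ℕ / coef(X,(xₙ))`. -/
def schauderRel (x : ℕ → X) : Setoid (ℕ → ℝ) := modRel (coef x)

end Decomposition

/-! Both parts are one statement about series `∑ T n (α n)` with closed embeddings `T n : W n →L[ℝ]
X`: inclusions of the summands, or `c ↦ c • x n`. Under bounded completeness, convergence means
bounded partial sums, an `F_σ` condition; testing the partial sums against a norming sequence of
functionals turns it into membership in `ℓ_∞`, by a continuous map. Conversely, a Borel reduction is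
continuous on a comeagre set, and a category argument over translates pulls the `F_σ` property of
`ℝ^ℕ/ℓ_∞` back to the set of convergent series. If that set is `⋃ F k`, Baire category in the space
of convergent partial-sum sequences, under the sup norm, puts a ball inside one `F k`. Small
multiples of all truncations of a bounded series fit in that ball, and `F k` is closed under their
coordinatewise limit. -/

/-! ### Baire category and Borel reductions -/

/-- A Borel map into a second countable space is continuous on a comeagre set. -/
theorem exists_residual_continuousOn {A B : Type*} [TopologicalSpace A] [TopologicalSpace B]
    [SecondCountableTopology B] {θ : A → B} (hθ : @Measurable A B (borel A) (borel B) θ) :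
    ∃ C ∈ residual A, ContinuousOn θ C := by
  borelize A B
  have hb := TopologicalSpace.isBasis_countableBasis B
  have key : ∀ W : TopologicalSpace.countableBasis B, ∃ u : Set A, IsOpen u ∧
      ∀ᶠ x in residual A, (x ∈ θ ⁻¹' W.1 ↔ x ∈ u) := by
    intro W
    obtain ⟨u, hu, h⟩ := (hθ (hb.isOpen W.2).measurableSet).residualEq_isOpen
    exact ⟨u, hu, Filter.eventuallyEq_set.1 h⟩
  choose u hu h using key
  have : Countable (TopologicalSpace.countableBasis B) :=
    (TopologicalSpace.countable_countableBasis B).to_subtype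
  refine ⟨{x | ∀ W, x ∈ θ ⁻¹' W.1 ↔ x ∈ u W}, eventually_countable_forall.2 h, ?_⟩
  intro x hx
  rw [ContinuousWithinAt, hb.nhds_hasBasis.tendsto_right_iff]
  rintro W ⟨hW, hxW⟩
  filter_upwards [inter_mem_nhdsWithin _ ((hu ⟨W, hW⟩).mem_nhds ((hx ⟨W, hW⟩).1 hxW))] with y hy
  exact (hy.1 ⟨W, hW⟩).2 hy.2

/-- A coset equivalence relation that is Borel reducible to an `F_σ` equivalence relation is
given by an `F_σ` set. -/
theorem BorelReducible.isFsigma_of_coset {G B : Type*} [AddGroup G] [TopologicalSpace G]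
    [IsTopologicalAddGroup G] [SecondCountableTopology G] [BaireSpace G] [TopologicalSpace B]
    [SecondCountableTopology B] {E : Setoid G} {F : Setoid B} (hEF : BorelReducible E F)
    (hF : IsFsigma {p : B × B | F p.1 p.2}) {S : Set G} (hE : ∀ x y, E x y ↔ x - y ∈ S) :
    IsFsigma S := by
  obtain ⟨θ, hθ, hred⟩ := hEF
  obtain ⟨C, hC, hcont⟩ := exists_residual_continuousOn hθ
  obtain ⟨Z, hZ, hFZ⟩ := hF
  have hprod : ContinuousOn (fun p : G × G => (θ p.1, θ p.2)) (C ×ˢ C) :=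
    (hcont.comp continuousOn_fst fun p hp => hp.1).prodMk
      (hcont.comp continuousOn_snd fun p hp => hp.2)
  choose K hK hKZ using fun n => continuousOn_iff_isClosed.1 hprod (Z n) (hZ n)
  have hS : ∀ x y, x ∈ C → y ∈ C → (x - y ∈ S ↔ ∃ n, (x, y) ∈ K n) := by
    intro x y hx hy
    have hxy : (x, y) ∈ C ×ˢ C := ⟨hx, hy⟩
    have h1 : ∀ n, (x, y) ∈ K n ↔ (θ x, θ y) ∈ Z n := by
      intro n
      have := Set.ext_iff.1 (hKZ n) (x, y)
      simp only [Set.mem_inter_iff, hxy, and_true, Set.mem_preimage] at this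
      exact this.symm
    rw [← hE, hred]
    simp only [h1, ← Set.mem_iUnion, ← hFZ, Set.mem_ofPred_eq]
  obtain ⟨b, hbc, hbe, hb⟩ := TopologicalSpace.exists_countable_basis G
  have : Countable b := hbc.to_subtype
  -- No restriction to `C` here, so `D q` is closed; since `x` and `h + x` both lie in `C` for
  -- comeagrely many `x`, one good `x` in the basic open set still decides whether `h ∈ S`.
  let D : ℕ × b → Set G := fun q => {h | ∀ x ∈ q.2.1, (h + x, x) ∈ K q.1}
  have hD : ∀ q, IsClosed (D q) := by
    intro q
    have : D q = ⋂ x ∈ q.2.1, (fun h => (h + x, x)) ⁻¹' K q.1 := by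
      ext h; simp [D]
    rw [this]
    exact isClosed_biInter fun x _ => (hK _).preimage (by fun_prop)
  have hshift : ∀ h : G, {x | h + x ∈ C ∧ x ∈ C} ∈ residual G := fun h =>
    Filter.inter_mem
      (tendsto_residual_of_isOpenMap (continuous_const_add h) (isOpenMap_add_left h) hC) hC
  have hSD : S = ⋃ q, D q := by
    ext h
    rw [Set.mem_iUnion]
    constructor
    · intro hh
      have hclosed : ∀ n, IsClosed {x | (h + x, x) ∈ K n} := fun n =>
        (hK n).preimage (f := fun x => (h + x, x)) (by fun_prop)
      -- For `h ∈ S` these closed sets cover a comeagre set, so they cannot all be nowhere dense.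
      obtain ⟨n, hn⟩ : ∃ n, (interior {x | (h + x, x) ∈ K n}).Nonempty := by
        by_contra! hemp
        have hnot : ∀ n, ∀ᶠ x in residual G, (h + x, x) ∉ K n := fun n =>
          residual_of_dense_open (hclosed n).isOpen_compl
            (interior_eq_empty_iff_dense_compl.1 (hemp n))
        obtain ⟨x, hx, hxn⟩ := (dense_of_mem_residual
          (Filter.inter_mem (hshift h) (eventually_countable_forall.2 hnot))).nonempty
        obtain ⟨n, hn⟩ := (hS (h + x) x hx.1 hx.2).1 (by simpa using hh)
        exact hxn n hn
      obtain ⟨x, hx⟩ := hn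
      obtain ⟨U, hU, -, hUs⟩ := hb.exists_subset_of_mem_open hx isOpen_interior
      exact ⟨(n, ⟨U, hU⟩), fun y hy => by
        have := interior_subset (hUs hy)
        exact this⟩
    · rintro ⟨⟨n, U, hU⟩, hh⟩
      have hUne : U.Nonempty := Set.nonempty_iff_ne_empty.2 fun h0 => hbe (h0 ▸ hU)
      obtain ⟨x, hxU, hx⟩ := (dense_of_mem_residual (hshift h)).inter_open_nonempty U
        (hb.isOpen hU) hUne
      simpa using (hS (h + x) x hx.1 hx.2).2 ⟨n, hh x hxU⟩
  have hbne : Nonempty b := by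
    obtain ⟨U, hU, -⟩ := hb.exists_subset_of_mem_open (Set.mem_univ (0 : G)) isOpen_univ
    exact ⟨⟨U, hU⟩⟩
  obtain ⟨e, he⟩ := exists_surjective_nat (ℕ × b)
  exact ⟨fun n => D (e n), fun n => hD _, hSD.trans (he.iUnion_comp D).symm⟩

/-! ### Bounded sequences and norming functionals -/

theorem isFsigma_modRel_ellInfty :
    IsFsigma {p : (ℕ → ℝ) × (ℕ → ℝ) | modRel ellInfty p.1 p.2} := by
  refine ⟨fun j => ⋂ n, {p | |p.1 n - p.2 n| ≤ j}, fun j => isClosed_iInter fun n =>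
    isClosed_le (by fun_prop) continuous_const, ?_⟩
  ext p
  simp only [Set.mem_iUnion, Set.mem_iInter, Set.mem_ofPred_eq]
  constructor
  · rintro ⟨C, hC⟩
    obtain ⟨j, hj⟩ := exists_nat_ge C
    exact ⟨j, fun n => (hC n).trans hj⟩
  · rintro ⟨j, hj⟩
    exact ⟨j, hj⟩

theorem partialSumsBounded_iff {X : Type*} [NormedAddCommGroup X] {x : ℕ → X} :
    PartialSumsBounded x ↔ ∃ C : ℝ, ∀ n : ℕ, ‖∑ i ∈ Finset.range n, x i‖ ≤ C := by
  refine ⟨fun ⟨C, hC⟩ => ⟨C, fun n => ?_⟩, fun ⟨C, hC⟩ => ⟨C, fun n => hC _⟩⟩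
  cases n with
  | zero => simpa using (norm_nonneg _).trans (hC 0)
  | succ n => exact hC n

theorem SeriesConverges.partialSumsBounded {X : Type*} [NormedAddCommGroup X] {x : ℕ → X}
    (h : SeriesConverges x) : PartialSumsBounded x := by
  obtain ⟨s, hs⟩ := h
  obtain ⟨C, hC⟩ := (Metric.isBounded_range_of_tendsto _ hs).exists_norm_le
  exact partialSumsBounded_iff.2 ⟨C, fun n => hC _ ⟨n, rfl⟩⟩

/-- Take Hahn–Banach functionals norming the points of a dense sequence; at a nearby `x` each loses
at most twice the distance. -/
theorem exists_norming_sequence (X : Type*) [NormedAddCommGroup X] [NormedSpace ℝ X]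
    [TopologicalSpace.SeparableSpace X] :
    ∃ f : ℕ → StrongDual ℝ X, (∀ k, ‖f k‖ ≤ 1) ∧
      ∀ (x : X) (C : ℝ), (∀ k, |f k x| ≤ C) → ‖x‖ ≤ C := by
  choose g hg hgx using fun x : X => exists_dual_vector'' ℝ x
  refine ⟨fun k => g (TopologicalSpace.denseSeq X k), fun k => hg _, fun x C hC => ?_⟩
  refine le_of_forall_pos_le_add fun ε hε => ?_
  obtain ⟨k, hk⟩ := (TopologicalSpace.denseRange_denseSeq X).exists_dist_lt x (half_pos hε)
  set u := TopologicalSpace.denseSeq X k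
  rw [dist_eq_norm] at hk
  have h1 : ‖u‖ = g u x - g u (x - u) := by rw [map_sub, hgx]; simp
  have h2 : |g u (x - u)| ≤ ‖x - u‖ := by
    simpa using (g u).le_of_opNorm_le (hg u) (x - u)
  have h3 : ‖x‖ ≤ ‖u‖ + ‖x - u‖ := by simpa using norm_add_le u (x - u)
  have h4 := hC k
  have h5 := le_abs_self (g u x)
  have h6 := neg_abs_le (g u (x - u))
  change |g u x| ≤ C at h4
  linarith

/-! ### Series with terms in the ranges of operators -/

section Family

variable {X : Type*} [NormedAddCommGroup X] [NormedSpace ℝ X]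
  {W : ℕ → Type*} [∀ n, NormedAddCommGroup (W n)] [∀ n, NormedSpace ℝ (W n)]

theorem isFsigma_setOf_seriesConverges_of_bounded (T : ∀ n, W n →L[ℝ] X)
    (h : ∀ α : ∀ n, W n, PartialSumsBounded (fun n => T n (α n)) →
      SeriesConverges (fun n => T n (α n))) :
    IsFsigma {α : ∀ n, W n | SeriesConverges (fun n => T n (α n))} := by
  refine ⟨fun j => ⋂ n, {α | ‖∑ i ∈ Finset.range n, T i (α i)‖ ≤ j}, fun j =>
    isClosed_iInter fun n => isClosed_le (by fun_prop) continuous_const, ?_⟩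
  ext α
  simp only [Set.mem_iUnion, Set.mem_iInter, Set.mem_ofPred_eq]
  constructor
  · intro hα
    obtain ⟨C, hC⟩ := partialSumsBounded_iff.1 hα.partialSumsBounded
    obtain ⟨j, hj⟩ := exists_nat_ge C
    exact ⟨j, fun n => (hC n).trans hj⟩
  · rintro ⟨j, hj⟩
    exact h α (partialSumsBounded_iff.2 ⟨j, hj⟩)

theorem borelReducible_of_bounded [TopologicalSpace.SeparableSpace X] (T : ∀ n, W n →L[ℝ] X)
    {E : Setoid (∀ n, W n)}
    (hE : ∀ α β, E α β ↔ SeriesConverges (fun n => T n ((α - β) n)))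
    (h : ∀ α : ∀ n, W n, PartialSumsBounded (fun n => T n (α n)) →
      SeriesConverges (fun n => T n (α n))) :
    BorelReducible E (modRel ellInfty) := by
  obtain ⟨f, hf, hnorm⟩ := exists_norming_sequence X
  -- `m` codes a pair: a partial sum and a functional to test it with.
  let θ : (∀ n, W n) → ℕ → ℝ := fun α m =>
    f m.unpair.2 (∑ i ∈ Finset.range m.unpair.1, T i (α i))
  have hθ : Continuous θ := by fun_prop
  refine ⟨θ, ?_, fun α β => ?_⟩
  · borelize (∀ n, W n) (ℕ → ℝ)
    exact hθ.measurable
  have hdiff : ∀ m, (θ α - θ β) m =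
      f m.unpair.2 (∑ i ∈ Finset.range m.unpair.1, T i ((α - β) i)) := fun m => by
    simp [θ]
  have hb : E α β ↔ PartialSumsBounded (fun n => T n ((α - β) n)) := by
    rw [hE]
    exact ⟨fun h => h.partialSumsBounded, h _⟩
  rw [hb, partialSumsBounded_iff]
  change _ ↔ ∃ C : ℝ, ∀ m, |(θ α - θ β) m| ≤ C
  refine exists_congr fun C => ⟨fun hC m => ?_, fun hC n => hnorm _ _ fun k => ?_⟩
  · rw [hdiff]
    exact ((f _).le_of_opNorm_le (hf _) _).trans (by simpa using hC _)
  · simpa [hdiff] using hC (Nat.pair n k)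

/-- The bounded sequences of partial sums of convergent series with terms in the ranges of the
maps `T n`. -/
def convergentPartialSums (T : ∀ n, W n →L[ℝ] X) : Set (BoundedContinuousFunction ℕ X) :=
  {s | (∀ n, s (n + 1) - s n ∈ Set.range (T n)) ∧ s 0 = 0 ∧ CauchySeq s}

/-- A uniform limit of Cauchy sequences is Cauchy; the other conditions are closed at each
coordinate. -/
theorem isClosed_convergentPartialSums {T : ∀ n, W n →L[ℝ] X}
    (hT : ∀ n, Topology.IsClosedEmbedding (T n)) : IsClosed (convergentPartialSums T) := by
  have h1 : IsClosed {s : BoundedContinuousFunction ℕ X | CauchySeq s} := by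
    refine isClosed_of_closure_subset fun s hs => ?_
    rw [Set.mem_ofPred_eq, Metric.cauchySeq_iff']
    intro ε hε
    obtain ⟨t, ht, hst⟩ := Metric.mem_closure_iff.1 hs (ε / 3) (by positivity)
    obtain ⟨N, hN⟩ := Metric.cauchySeq_iff'.1 ht (ε / 3) (by positivity)
    refine ⟨N, fun n hn => ?_⟩
    have ha := (BoundedContinuousFunction.dist_coe_le_dist (f := s) (g := t) n)
    have hb := (BoundedContinuousFunction.dist_coe_le_dist (f := s) (g := t) N)
    rw [dist_comm] at hb
    have := dist_triangle4 (s n) (t n) (t N) (s N)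
    linarith [hN n hn]
  refine IsClosed.inter (s₁ := {s | ∀ n, s (n + 1) - s n ∈ Set.range (T n)}) ?_
    (IsClosed.inter (s₁ := {s | s 0 = 0}) ?_ h1)
  · rw [Set.ofPred_forall]
    refine isClosed_iInter fun n => (hT n).isClosed_range.preimage
      (f := fun s : BoundedContinuousFunction ℕ X => s (n + 1) - s n) ?_
    exact (BoundedContinuousFunction.lipschitz_eval_const _).continuous.sub
      (BoundedContinuousFunction.lipschitz_eval_const _).continuous
  · exact isClosed_eq (BoundedContinuousFunction.lipschitz_eval_const 0).continuous continuous_const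

theorem exists_convergentPartialSums {T : ∀ n, W n →L[ℝ] X} {α : ∀ n, W n}
    (h : SeriesConverges (fun n => T n (α n))) :
    ∃ s ∈ convergentPartialSums T, ∀ n, s n = ∑ i ∈ Finset.range n, T i (α i) := by
  obtain ⟨C, hC⟩ := partialSumsBounded_iff.1 h.partialSumsBounded
  obtain ⟨x, hx⟩ := h
  refine ⟨BoundedContinuousFunction.ofNormedAddCommGroupDiscrete _ C hC,
    ⟨fun n => ⟨α n, ?_⟩, ?_, ?_⟩, fun n => rfl⟩
  · simp [Finset.sum_range_succ]
  · simp
  · exact Tendsto.cauchySeq hx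

theorem seriesConverges_of_bounded_of_isFsigma [CompleteSpace X] {T : ∀ n, W n →L[ℝ] X}
    (hT : ∀ n, Topology.IsClosedEmbedding (T n))
    (hF : IsFsigma {α : ∀ n, W n | SeriesConverges (fun n => T n (α n))})
    {a : ∀ n, W n} (ha : PartialSumsBounded (fun n => T n (a n))) :
    SeriesConverges (fun n => T n (a n)) := by
  obtain ⟨F, hFc, hFS⟩ := hF
  have hFS' : ∀ α : ∀ n, W n, SeriesConverges (fun n => T n (α n)) ↔ ∃ k, α ∈ F k := fun α => by
    rw [← Set.mem_iUnion, ← hFS, Set.mem_ofPred_eq]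
  have : CompleteSpace (convergentPartialSums T) :=
    (isClosed_convergentPartialSums hT).completeSpace_coe
  -- `γ` recovers the terms from the partial sums; it is continuous into the product because each `T
  -- n` is an embedding.
  choose γ hγ using fun (s : convergentPartialSums T) n => s.2.1 n
  have hγc : Continuous γ := by
    refine continuous_pi fun n => (hT n).isInducing.continuous_iff.2 ?_
    have : (T n ∘ fun s => γ s n) = fun s : convergentPartialSums T => s.1 (n + 1) - s.1 n :=
      funext fun s => hγ s n
    rw [this]
    exact ((BoundedContinuousFunction.lipschitz_eval_const _).continuous.comp continuous_subtype_val).sub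
      ((BoundedContinuousFunction.lipschitz_eval_const _).continuous.comp continuous_subtype_val)
  have hsum : ∀ s n, s.1 n = ∑ i ∈ Finset.range n, T i (γ s i) := fun s n => by
    simp_rw [hγ, Finset.sum_range_sub (fun i => s.1 i), s.2.2.1, sub_zero]
  have hγS : ∀ s, SeriesConverges (fun n => T n (γ s n)) := fun s => by
    obtain ⟨x, hx⟩ := cauchySeq_tendsto_of_complete s.2.2.2
    exact ⟨x, by simpa only [SeriesHasSum, ← hsum] using hx⟩
  have hne : Nonempty (convergentPartialSums T) :=
    ⟨⟨0, fun n => ⟨0, by simp⟩, by simp, cauchySeq_const (0 : X)⟩⟩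
  obtain ⟨k, s₀, hs₀⟩ := nonempty_interior_of_iUnion_of_closed
    (f := fun k => γ ⁻¹' F k) (fun k => (hFc k).preimage hγc)
    (Set.eq_univ_of_forall fun s => Set.mem_iUnion.2 ((hFS' _).1 (hγS s)))
  obtain ⟨r, hr, hball⟩ := Metric.isOpen_iff.1 isOpen_interior s₀ hs₀
  obtain ⟨C, hC⟩ := partialSumsBounded_iff.1 ha
  have hC0 : 0 ≤ C := (norm_nonneg _).trans (hC 0)
  -- The scale gives `c * C < r`, even when `C = 0`.
  set c : ℝ := r / (2 * (C + 1)) with hc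
  have hcpos : 0 < c := by positivity
  have hcC : c * C < r := by
    rw [hc, div_mul_eq_mul_div, div_lt_iff₀ (by positivity)]
    nlinarith
  -- Truncations of `a`: finite series, with partial sums bounded by the same `C` for every `N`.
  let t : ℕ → ∀ n, W n := fun N n => if n < N then a n else 0
  have htsum : ∀ N n, ∑ i ∈ Finset.range n, T i (t N i) =
      ∑ i ∈ Finset.range (min n N), T i (a i) := by
    intro N n
    have : ∀ i, T i (t N i) = if i < N then T i (a i) else 0 := fun i => by
      simp only [t]; split_ifs <;> simp
    simp_rw [this]
    rw [← Finset.sum_filter]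
    congr 1
    ext i
    simp
  have htconv : ∀ N, SeriesConverges (fun n => T n (t N n)) := fun N => by
    refine ⟨∑ i ∈ Finset.range N, T i (a i), tendsto_const_nhds.congr' ?_⟩
    filter_upwards [eventually_ge_atTop N] with n hn
    rw [htsum, min_eq_right hn]
  have hmem : ∀ N, γ s₀ + c • t N ∈ F k := by
    intro N
    have hconv : SeriesConverges (fun n => T n ((γ s₀ + c • t N) n)) := by
      simpa using (hγS s₀).add ((htconv N).smul c)
    obtain ⟨s, hs, hseq⟩ := exists_convergentPartialSums hconv
    have heq : γ ⟨s, hs⟩ = γ s₀ + c • t N := funext fun n => (hT n).injective <| by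
      rw [hγ]
      simp only [hseq, Finset.sum_range_succ, add_sub_cancel_left]
    have hdist : dist (⟨s, hs⟩ : convergentPartialSums T) s₀ < r := by
      refine lt_of_le_of_lt ?_ hcC
      rw [Subtype.dist_eq, BoundedContinuousFunction.dist_le (by positivity)]
      intro n
      have : s n - s₀.1 n = c • ∑ i ∈ Finset.range (min n N), T i (a i) := by
        rw [hseq, hsum, ← htsum]
        simp [Finset.sum_add_distrib, Finset.smul_sum]
      rw [dist_eq_norm, this, norm_smul, Real.norm_of_nonneg hcpos.le]
      exact mul_le_mul_of_nonneg_left (hC _) hcpos.le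
    rw [← heq]
    have := interior_subset (hball hdist)
    exact this
  -- Each coordinate is eventually constant in `N`, so the product topology gives the limit without
  -- any convergence of `∑ T n (a n)`.
  have hlim : Tendsto (fun N => γ s₀ + c • t N) atTop (𝓝 (γ s₀ + c • a)) := by
    refine tendsto_pi_nhds.2 fun n => tendsto_const_nhds.congr' ?_
    filter_upwards [eventually_gt_atTop n] with N hN
    simp [t, hN]
  have hfin := (hFS' _).2 ⟨k, (hFc k).mem_of_tendsto hlim (Eventually.of_forall hmem)⟩
  have := (hfin.add ((hγS s₀).smul (-1))).smul c⁻¹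
  simpa [smul_smul, hcpos.ne'] using this

/-! ### The equivalences and the two special cases -/

theorem tfae_boundedlyComplete [CompleteSpace X] [TopologicalSpace.SeparableSpace X]
    [∀ n, CompleteSpace (W n)] [∀ n, SecondCountableTopology (W n)] {T : ∀ n, W n →L[ℝ] X}
    (hT : ∀ n, Topology.IsClosedEmbedding (T n)) {E : Setoid (∀ n, W n)}
    (hE : ∀ α β, E α β ↔ SeriesConverges (fun n => T n ((α - β) n))) :
    List.TFAE
      [∀ α : ∀ n, W n, PartialSumsBounded (fun n => T n (α n)) →
          SeriesConverges (fun n => T n (α n)),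
        IsFsigma {α : ∀ n, W n | SeriesConverges (fun n => T n (α n))},
        BorelReducible E (modRel ellInfty)] := by
  tfae_have 1 → 2 := isFsigma_setOf_seriesConverges_of_bounded T
  tfae_have 2 → 1 := fun h _ => seriesConverges_of_bounded_of_isFsigma hT h
  tfae_have 1 → 3 := borelReducible_of_bounded T hE
  tfae_have 3 → 2 := fun h => h.isFsigma_of_coset isFsigma_modRel_ellInfty hE
  tfae_finish

/-- A zero vector would give `0` two expansions. This makes `c ↦ c • x n` a closed embedding. -/
theorem IsSchauderBasis.ne_zero {x : ℕ → X} (hx : IsSchauderBasis x) (n : ℕ) : x n ≠ 0 := by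
  intro h0
  have h := (hx 0).unique (y₁ := 0) (y₂ := Pi.single n 1) (by simp [SeriesHasSum]) (by
    have : (fun i => (Pi.single n 1 : ℕ → ℝ) i • x i) = 0 := by
      ext i
      rcases eq_or_ne i n with rfl | hi
      · simp [h0]
      · simp [hi]
    simp [SeriesHasSum, this])
  simpa using congrFun h n

theorem IsSchauderBasis.separableSpace {x : ℕ → X} (hx : IsSchauderBasis x) :
    TopologicalSpace.SeparableSpace X := by
  rw [← TopologicalSpace.isSeparable_univ_iff]
  have h := ((Set.countable_range x).isSeparable.span (R := ℝ)).closure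
  refine h.mono fun y _ => ?_
  obtain ⟨a, ha, -⟩ := hx y
  exact mem_closure_of_tendsto ha (Eventually.of_forall fun n => Submodule.sum_mem _ fun i _ =>
    Submodule.smul_mem _ _ (Submodule.subset_span ⟨i, rfl⟩))

end Family

theorem theorem3p2 (X : Type*) [NormedAddCommGroup X] [NormedSpace ℝ X] [CompleteSpace X] :
    (TopologicalSpace.SeparableSpace X →
      ∀ V : ℕ → Submodule ℝ X, IsSchauderDecomposition V →
        List.TFAE
          [IsBoundedlyCompleteDecomposition V,
            IsFsigma (csSet V),
            BorelReducible (decompositionRel V) (modRel ellInfty)]) ∧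
    (∀ x : ℕ → X, IsSchauderBasis x →
        List.TFAE
          [IsBoundedlyCompleteBasis x,
            IsFsigma (coef x : Set (ℕ → ℝ)),
            BorelReducible (schauderRel x) (modRel ellInfty)]) := by
  refine ⟨fun _ V hV => ?_, fun x hx => ?_⟩
  · have hc : ∀ n, CompleteSpace (V n) := fun n => (hV.1 n).completeSpace_coe
    have : SecondCountableTopology X := UniformSpace.secondCountable_of_separable X
    exact tfae_boundedlyComplete (T := fun n => (V n).subtypeL)
      (fun n => (hV.1 n).isClosedEmbedding_subtypeVal) fun α β => Iff.rfl
  · have := hx.separableSpace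
    refine tfae_boundedlyComplete
      (T := fun n => (ContinuousLinearMap.id ℝ ℝ).smulRight (x n)) (fun n => ?_) fun a b => Iff.rfl
    exact isClosedEmbedding_smul_left (hx.ne_zero n)
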